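/- \textbf{Definitions.} A \emph{tree-form decision problem} is a finite rooted tree in which two kinds of nodes alternate: decision points $j\in\mathcal J$ and observation points (sequences) $\sigma\in\Sigma$. The root $\varnothing$ is an observation point. Each decision point $j$ has a parent observation point $p_j$ and a nonempty set $A_j$ of actions, and the observation points other than $\varnothing$ are the children $ja$ ($j\in\mathcal J$, $a\in A_j$) of the decision points. For $\sigma\in\Sigma$ let $C_\sigma=\{j\in\mathcal J: p_j=\sigma\}$. Selecting one action at every decision point gives the \emph{sequence-form pure strategy} $x\in\{0,1\}^{\Sigma}$ with $x(\sigma)=1$ if and only if all actions on the path from $\varnothing$ to $\sigma$ are selected. The set of these vectors is the \emph{sequence-form strategy set}, and $\operatorname{co}$ denotes its convex hull. Let $\mathcal X,\mathcal Y$ be the sequence-form strategy sets of two tree-form decision problems with nodes $\Sigma_{\mathcal X}\cup\mathcal J_{\mathcal X}$ and $\Sigma_{\mathcal Y}\cup\mathcal J_{\mathcal Y}$. Consider the following decision problem of a deviator on a directed acyclic graph, whose nodes are pairs $(s,\tilde s)$ with $s\in\Sigma_{\mathcal X}\cup\mathcal J_{\mathcal X}$ and $\tilde s\in\Sigma_{\mathcal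 Y}\cup\mathcal J_{\mathcal Y}$ and whose root is $(\varnothing,\varnothing)$: \begin{itemize} \item At $(\sigma,\tilde\sigma)\in\Sigma_{\mathcal X}\times\Sigma_{\mathcal Y}$ the deviator observes some $j\in C_\sigma$ and moves to $(j,\tilde\sigma)$. \item At $(j,\tilde\sigma)\in\mathcal J_{\mathcal X}\times\Sigma_{\mathcal Y}$ the deviator chooses either to play an action $a\in A_j$, moving to $(ja,\tilde\sigma)$, or to query a decision point $\tilde\jmath\in C_{\tilde\sigma}$, moving to $(j,\tilde\jmath)$. \item At $(j,\tilde\jmath)\in\mathcal J_{\mathcal X}\times\mathcal J_{\mathcal Y}$ the deviator observes an action $a\in A_{\tilde\jmath}$ recommended by a mediator and moves to $(j,\tilde\jmath a)$. A mediator holding $y\in\mathcal Y$ recommends the action $a$ with $y(\tilde\jmath a)=1$. \end{itemize} A \emph{pure strategy} of the deviator fixes one choice at every $(j,\tilde\sigma)\in\mathcal J_{\mathcal X}\times\Sigma_{\mathcal Y}$. A \emph{(mixed) strategy} is a probability distribution over pure strategies. A strategy \emph{induces} the function $\phi$ on $\mathcal Y$ for which $\phi(y)(\sigma)$, with $y\in\mathcal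 Y$ and $\sigma\in\Sigma_{\mathcal X}$, is the probability that the deviator plays all the actions on the path to $\sigma$ when the mediator holds $y$. This means that some node $(\sigma,\tilde\sigma)$ is reached from $(\varnothing,\varnothing)$ by a path on which the deviator follows its strategy and the mediator replies according to $y$. \textbf{Theorem.} Let $\mathcal X,\mathcal Y$ be sequence-form strategy sets. The linear maps $\mathcal Y\to\operatorname{co}\mathcal X$, that is, the functions $\phi:\mathcal Y\to\operatorname{co}\mathcal X$ that are restrictions of linear maps $\mathbb R^{\Sigma_{\mathcal Y}}\to\mathbb R^{\Sigma_{\mathcal X}}$, are precisely the functions induced by (mixed) strategies of the deviator in this decision problem. In particular, every induced function takes values in $\operatorname{co}\mathcal X$. -/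

import Mathlib

universe u v

/-- A finite tree-form decision problem: a finite rooted tree in which observation points
(sequences) and decision points alternate and whose root is an observation point.

An observation point other than the root is the pair `ja` of a decision point `j` and an action
`a` legal at `j`, and `j` is its parent; so the set of sequences is `Option (Σ j, Action j)`, where
`none` is the root `∅`. The remaining data of the tree is the parent `p_j` of each decision point,
and well-foundedness says that the parent links have no cycle, so that every node lies below `∅`. -/
structure TreeFormDecisionProblem where
  /-- decision points -/
  Dec : Type u
  /-- the legal actions at a decision point -/
  Action : Dec → Type u
  /-- the observation point that immediately precedes a decision point -/
  parent : Dec → Option (Σ j : Dec, Action j)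
  finite_dec : Finite Dec
  finite_action : ∀ j, Finite (Action j)
  nonempty_action : ∀ j, Nonempty (Action j)
  wf : WellFounded fun i j : Dec => ∃ a : Action i, parent j = some ⟨i, a⟩

namespace TreeFormDecisionProblem

attribute [instance] finite_dec finite_action nonempty_action

/-- The observation points `Σ` (sequences) of a tree-form decision problem. -/
abbrev Seq (X : TreeFormDecisionProblem.{u}) : Type u := Option (Σ j : X.Dec, X.Action j)

/-- The root observation point `∅`. -/
abbrev root (X : TreeFormDecisionProblem.{u}) : X.Seq := none

/-- The observation point `ja`. -/
abbrev seq (X : TreeFormDecisionProblem.{u}) (j : X.Dec) (a : X.Action j) : X.Seq := some ⟨j, a⟩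

/-- All nodes of the tree, `Σ ∪ J`. -/
inductive Node (X : TreeFormDecisionProblem.{u}) : Type u
  /-- an observation point -/
  | obs (σ : X.Seq) : Node X
  /-- a decision point -/
  | dec (j : X.Dec) : Node X

/-- `X.Plays f σ`: the player who selects the action `f j` at each decision point `j` selects every
action on the path from the root to `σ`. -/
inductive Plays (X : TreeFormDecisionProblem.{u}) (f : ∀ j, X.Action j) : X.Seq → Prop
  | root : Plays X f X.root
  | step (j : X.Dec) : Plays X f (X.parent j) → Plays X f (X.seq j (f j))

open Classical in
/-- The sequence form of a selection of one action at each decision point. -/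
noncomputable def seqForm (X : TreeFormDecisionProblem.{u}) (f : ∀ j, X.Action j) : X.Seq → ℝ :=
  fun σ => if X.Plays f σ then 1 else 0

/-- The set `𝒳` of sequence-form pure strategies. -/
def pureStrategies (X : TreeFormDecisionProblem.{u}) : Set (X.Seq → ℝ) :=
  Set.range X.seqForm

/-- The set `co 𝒳` of sequence-form mixed strategies. -/
def mixedStrategies (X : TreeFormDecisionProblem.{u}) : Set (X.Seq → ℝ) :=
  convexHull ℝ X.pureStrategies

/-- The linear maps `𝒴 → co 𝒳`: functions on `𝒴` with values in `co 𝒳` that are restrictions of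
linear maps between the ambient spaces. -/
def linearMaps (Y : TreeFormDecisionProblem.{v}) (X : TreeFormDecisionProblem.{u}) :
    Set (Y.pureStrategies → X.Seq → ℝ) :=
  {φ | (∀ y, φ y ∈ X.mixedStrategies) ∧
    ∃ L : (Y.Seq → ℝ) →ₗ[ℝ] (X.Seq → ℝ), ∀ y : Y.pureStrategies, φ y = L y}

end TreeFormDecisionProblem

/-! ### The untimed communication (UTC) decision problem

The nodes are pairs `(s, t)` of a node `s` of `X` (the state of the real decision problem) and a
node `t` of `Y` (the state of the interaction with the mediator); the decision points are the pairs
`(j, τ)` with `j` a decision point of `X` and `τ` an observation point of `Y`. -/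

namespace UTC

open TreeFormDecisionProblem

/-- What the deviator can do at the decision point `(j, τ)`: play an action legal at `j` in the
real decision problem, or query the mediator at a decision point `q` of `Y` that follows `τ`. -/
abbrev Choice (X : TreeFormDecisionProblem.{u}) (Y : TreeFormDecisionProblem.{v})
    (j : X.Dec) (τ : Y.Seq) : Type (max u v) :=
  X.Action j ⊕ {q : Y.Dec // Y.parent q = τ}

/-- A pure strategy of the deviator: one choice at each decision point of the UTC DAG. -/
abbrev PureStrategy (X : TreeFormDecisionProblem.{u}) (Y : TreeFormDecisionProblem.{v}) :
    Type (max u v) :=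
  ∀ (j : X.Dec) (τ : Y.Seq), Choice X Y j τ

noncomputable instance (X : TreeFormDecisionProblem.{u}) (Y : TreeFormDecisionProblem.{v}) :
    Fintype (PureStrategy X Y) :=
  Fintype.ofFinite _

/-- `Reaches π y s t`: there is a path in the UTC DAG from `(∅, ∅)` to `(s, t)` on which the
deviator plays by the pure strategy `π` and the mediator replies to each query `q` by the
action that `y` recommends at `q`, that is, the `b` with `y (q b) = 1`. -/
inductive Reaches {X : TreeFormDecisionProblem.{u}} {Y : TreeFormDecisionProblem.{v}}
    (π : PureStrategy X Y) (y : Y.Seq → ℝ) : X.Node → Y.Node → Prop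
  /-- the root -/
  | root : Reaches π y (.obs X.root) (.obs Y.root)
  /-- `(σ, τ)` is an observation point: the next real decision point `j` is observed -/
  | observe (j : X.Dec) (τ : Y.Seq) :
      Reaches π y (.obs (X.parent j)) (.obs τ) → Reaches π y (.dec j) (.obs τ)
  /-- at `(j, τ)` the deviator plays an action in the real decision problem -/
  | act (j : X.Dec) (τ : Y.Seq) (a : X.Action j) :
      Reaches π y (.dec j) (.obs τ) → π j τ = .inl a → Reaches π y (.obs (X.seq j a)) (.obs τ)
  /-- at `(j, τ)` the deviator queries a decision point of the mediator that follows `τ` -/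
  | query (j : X.Dec) (τ : Y.Seq) (q : {q : Y.Dec // Y.parent q = τ}) :
      Reaches π y (.dec j) (.obs τ) → π j τ = .inr q → Reaches π y (.dec j) (.dec q)
  /-- `(j, q)` is an observation point: the action recommended at `q` is observed -/
  | reply (j : X.Dec) (q : Y.Dec) (b : Y.Action q) :
      Reaches π y (.dec j) (.dec q) → y (Y.seq q b) = 1 →
      Reaches π y (.dec j) (.obs (Y.seq q b))

/-- The deviator, using `π` against a mediator who recommends according to `y`, plays all the
actions on the path to `σ` in the real decision problem. -/
def PlaysTo {X : TreeFormDecisionProblem.{u}} {Y : TreeFormDecisionProblem.{v}}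
    (π : PureStrategy X Y) (y : Y.Seq → ℝ) (σ : X.Seq) : Prop :=
  ∃ τ : Y.Seq, Reaches π y (.obs σ) (.obs τ)

open Classical in
/-- The function induced by a mixed strategy `w`, a probability distribution on the pure
strategies: it sends `y ∈ 𝒴` to the vector whose `σ`-entry is the probability that the deviator
plays all the actions on the path to `σ` when the mediator recommends according to `y`. -/
noncomputable def inducedMap {X : TreeFormDecisionProblem.{u}} {Y : TreeFormDecisionProblem.{v}}
    (w : stdSimplex ℝ (PureStrategy X Y)) : Y.pureStrategies → X.Seq → ℝ :=
  fun y σ => ∑ π : PureStrategy X Y, if PlaysTo π y σ then w.1 π else 0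

end UTC

/-!
Fix a pure strategy of the deviator and replies of the mediator. The resulting play is
deterministic, so it prescribes one action at every decision point of `X`, and the vector it induces
is the sequence form of this response. Moreover whether `(σ, τ)` is reached splits into a condition
on the strategy alone (`(σ, τ)` is reached under some replies) and the condition `y τ = 1`; this is
linear in `y`.

Conversely, a linear map into `co 𝒳` has an extension that satisfies the homogeneous
sequence-form constraints on the whole ambient space. Normalize each of its coordinates, a linear
function on `𝒴`, by moving as much mass as possible towards the root of `Y`; this makes all
coefficients nonnegative. Since minimal values are superadditive, passing from the coordinate of
`p_j` to the coordinates of its successors `ja` only moves mass away from the root of `Y`, and the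
normalized coefficients together with the moved masses form a unit flow on the decision problem of
the deviator. The behavioral strategy that splits like this flow visits no node more often than the
flow does. So it induces a function bounded by the given one, and the two are equal because no
element of `co 𝒳` dominates another one.
-/

open scoped Matrix

section LinearAlgebra

variable {K V W : Type*} [DivisionRing K] [AddCommGroup V] [Module K V] [AddCommGroup W]
  [Module K W]

theorem exists_linearMap_eqOn_forall_mem (L : V →ₗ[K] W) {S : Set V} {U : Submodule K W}
    (hL : ∀ v ∈ S, L v ∈ U) : ∃ L' : V →ₗ[K] W, Set.EqOn L' L S ∧ ∀ v, L' v ∈ U := by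
  obtain ⟨P, hP⟩ := (Submodule.span K S).subtype.exists_leftInverse_of_injective
    (Submodule.ker_subtype _)
  have hspan : Submodule.span K S ≤ U.comap L := Submodule.span_le.2 hL
  refine ⟨L ∘ₗ (Submodule.span K S).subtype ∘ₗ P, fun v hv => ?_, fun v => hspan (P v).2⟩
  have hPv : P v = ⟨v, Submodule.subset_span hv⟩ :=
    LinearMap.congr_fun hP ⟨v, Submodule.subset_span hv⟩
  simp [hPv]

end LinearAlgebra

section ProductDistribution

variable {ι : Type*} [Fintype ι] [DecidableEq ι] {C : ι → Type*} [∀ i, Fintype (C i)]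

theorem sum_apply_mul_eq_sum_mul_sum {R : Type*} [CommSemiring R] {i : ι} (φ : C i → R)
    {G : (∀ k, C k) → R} (hG : DependsOn G {i}ᶜ) (c : C i) :
    ∑ p, φ (p i) * G p = (∑ x, φ x) * ∑ r, G ((Equiv.piSplitAt i C).symm (c, r)) := by
  rw [← (Equiv.piSplitAt i C).symm.sum_comp, Fintype.sum_prod_type, Fintype.sum_mul_sum]
  refine Finset.sum_congr rfl fun x _ => Finset.sum_congr rfl fun r _ => ?_
  congr 1
  · simp
  · refine hG fun k hk => ?_
    have hki : k ≠ i := hk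
    simp [hki]

open Classical in
theorem sum_prod_filter_apply_eq {R : Type*} [CommSemiring R] (β : ∀ i, C i → R) {i : ι}
    (hβ : ∑ c, β i c = 1) {E : (∀ k, C k) → Prop} (hE : DependsOn E {i}ᶜ) (c : C i) :
    ∑ p with E p ∧ p i = c, ∏ k, β k (p k) = β i c * ∑ p with E p, ∏ k, β k (p k) := by
  let G : (∀ k, C k) → R := fun p => if E p then ∏ k : {k // k ≠ i}, β k (p k) else 0
  have hG : DependsOn G {i}ᶜ := fun p p' h => by
    have hprod : ∏ k : {k // k ≠ i}, β k (p k) = ∏ k : {k // k ≠ i}, β k (p' k) :=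
      Finset.prod_congr rfl fun k _ => by rw [h k k.2]
    simp only [G, hE h, hprod]
  have hleft : ∑ p with E p ∧ p i = c, ∏ k, β k (p k) =
      ∑ p, (if p i = c then β i (p i) else 0) * G p := by
    rw [Finset.sum_filter]
    refine Finset.sum_congr rfl fun p _ => ?_
    by_cases hp : E p <;> by_cases hc : p i = c <;>
      simp [G, hp, hc, Fintype.prod_eq_mul_prod_subtype_ne _ i]
  have hright : ∑ p with E p, ∏ k, β k (p k) = ∑ p, β i (p i) * G p := by
    rw [Finset.sum_filter]
    refine Finset.sum_congr rfl fun p _ => ?_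
    by_cases hp : E p <;> simp [G, hp, Fintype.prod_eq_mul_prod_subtype_ne _ i]
  rw [hleft, hright, sum_apply_mul_eq_sum_mul_sum (fun x => if x = c then β i x else 0) hG c,
    sum_apply_mul_eq_sum_mul_sum (β i) hG c, hβ, one_mul, Fintype.sum_ite_eq']

end ProductDistribution

theorem exists_stdSimplex_mul_sum_eq {K C : Type*} [Field K] [LinearOrder K]
    [IsStrictOrderedRing K] [Fintype C] [Nonempty C] {F : C → K} (hF : 0 ≤ F) :
    ∃ p : stdSimplex K C, ∀ c, p c * ∑ c', F c' = F c := by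
  rcases eq_or_ne (∑ c, F c) 0 with h0 | h0
  · have hF0 : F = 0 := (Fintype.sum_eq_zero_iff_of_nonneg hF).1 h0
    exact ⟨Classical.arbitrary _, by simp [hF0]⟩
  · refine ⟨⟨fun c => F c / ∑ c', F c',
      fun c => div_nonneg (hF c) (Finset.sum_nonneg fun c _ => hF c), ?_⟩,
      fun c => div_mul_cancel₀ _ h0⟩
    rw [← Finset.sum_div, div_self h0]

namespace TreeFormDecisionProblem

variable (X : TreeFormDecisionProblem.{u})

noncomputable instance fintypeDec : Fintype X.Dec := Fintype.ofFinite _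

noncomputable instance fintypeAction (j : X.Dec) : Fintype (X.Action j) := Fintype.ofFinite _

noncomputable instance fintypeChildren (σ : X.Seq) : Fintype {j : X.Dec // X.parent j = σ} :=
  Fintype.ofFinite _

instance finite_node : Finite X.Node :=
  Finite.of_surjective (Sum.elim Node.obs Node.dec) fun
    | .obs σ => ⟨.inl σ, rfl⟩
    | .dec j => ⟨.inr j, rfl⟩

variable {X}

theorem seq_induction {P : X.Seq → Prop} (root : P X.root)
    (seq : ∀ j a, P (X.parent j) → P (X.seq j a)) (σ : X.Seq) : P σ := by
  have parent : ∀ j, P (X.parent j) := by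
    intro j
    induction j using X.wf.induction with
    | _ j ih =>
      rcases h : X.parent j with _ | ⟨i, a⟩
      · exact root
      · exact seq i a (ih i ⟨a, h⟩)
  rcases σ with _ | ⟨j, a⟩
  · exact root
  · exact seq j a (parent j)

/-- The depth of a decision point in the tree, in which the root has depth `0`. It is defined before
`Node.depth` because the recursion runs over decision points only. -/
noncomputable def decDepth (j : X.Dec) : ℕ :=
  match h : X.parent j with
  | none => 1
  | some ⟨i, a⟩ => decDepth i + 2
termination_by X.wf.wrap j
decreasing_by exact ⟨a, h⟩

/-- The depth of a node in the tree, in which the root has depth `0`. -/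
noncomputable def Node.depth : X.Node → ℕ
  | .obs none => 0
  | .obs (some s) => decDepth s.1 + 1
  | .dec j => decDepth j

theorem depth_seq (j : X.Dec) (a : X.Action j) :
    (Node.obs (X.seq j a)).depth = (Node.dec j).depth + 1 := rfl

theorem depth_dec (j : X.Dec) : (Node.dec j).depth = (Node.obs (X.parent j)).depth + 1 := by
  rw [Node.depth, decDepth]
  split <;> rename_i h <;> rw [h] <;> rfl

theorem wellFounded_depth_gt : WellFounded fun s s' : X.Node => s'.depth < s.depth :=
  have : IsTrans X.Node fun s s' => s'.depth < s.depth := ⟨fun _ _ _ h h' => h'.trans h⟩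
  have : Std.Irrefl fun s s' : X.Node => s'.depth < s.depth := ⟨fun _ => lt_irrefl _⟩
  Finite.wellFounded_of_trans_of_irrefl _

theorem depth_lt_depth_dec {j : X.Dec} {σ : X.Seq} (h : X.parent j = σ) :
    (Node.obs σ).depth < (Node.dec j).depth := by
  rw [depth_dec, h]
  exact Nat.lt_succ_self _

theorem depth_lt_depth_seq {j : X.Dec} {σ : X.Seq} (h : X.parent j = σ) (a : X.Action j) :
    (Node.obs σ).depth < (Node.obs (X.seq j a)).depth :=
  (depth_lt_depth_dec h).trans (Nat.lt_succ_self _)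

theorem node_induction_up {P : X.Node → Prop}
    (obs : ∀ σ, (∀ j, X.parent j = σ → P (.dec j)) → P (.obs σ))
    (dec : ∀ j, (∀ a, P (.obs (X.seq j a))) → P (.dec j)) (s : X.Node) : P s := by
  induction s using (wellFounded_depth_gt (X := X)).induction with
  | _ s ih =>
    rcases s with σ | j
    · exact obs σ fun j h => ih _ (depth_lt_depth_dec h)
    · exact dec j fun a => ih _ (Nat.lt_succ_self _)

/-! ### Sequence-form strategies -/

theorem plays_seq {f : ∀ j, X.Action j} {j : X.Dec} {a : X.Action j} :
    X.Plays f (X.seq j a) ↔ a = f j ∧ X.Plays f (X.parent j) := by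
  constructor
  · intro h
    cases h with
    | step _ hj => exact ⟨rfl, hj⟩
  · rintro ⟨rfl, h⟩
    exact .step j h

theorem seqForm_eq_one_iff {f : ∀ j, X.Action j} {σ : X.Seq} :
    X.seqForm f σ = 1 ↔ X.Plays f σ := by
  simp [seqForm]

theorem seqForm_nonneg (f : ∀ j, X.Action j) : 0 ≤ X.seqForm f := fun σ => by
  unfold seqForm
  split <;> simp

theorem seqForm_root (f : ∀ j, X.Action j) : X.seqForm f X.root = 1 :=
  seqForm_eq_one_iff.2 .root

theorem sum_mul_seqForm_seq (f : ∀ j, X.Action j) (j : X.Dec) (r : X.Action j → ℝ) :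
    ∑ a, r a * X.seqForm f (X.seq j a) = r (f j) * X.seqForm f (X.parent j) := by
  classical
  simp [seqForm, plays_seq, ite_and]

variable (X) in
/-- The subspace of `ℝ^Σ` cut out by the homogeneous sequence-form constraints: the mass of `p_j` is
distributed among the actions at `j`. -/
def conservativeVectors : Submodule ℝ (X.Seq → ℝ) where
  carrier := {x | ∀ j, ∑ a, x (X.seq j a) = x (X.parent j)}
  zero_mem' := by simp
  add_mem' hx hy j := by
    rw [Set.mem_ofPred_eq] at hx hy
    simp only [Pi.add_apply, Finset.sum_add_distrib, hx, hy]
  smul_mem' r x hx j := by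
    rw [Set.mem_ofPred_eq] at hx
    simp only [Pi.smul_apply, ← Finset.smul_sum, hx]

theorem mem_conservativeVectors {x : X.Seq → ℝ} :
    x ∈ X.conservativeVectors ↔ ∀ j, ∑ a, x (X.seq j a) = x (X.parent j) := Iff.rfl

theorem seqForm_mem_conservativeVectors (f : ∀ j, X.Action j) :
    X.seqForm f ∈ X.conservativeVectors :=
  fun j => by simpa using sum_mul_seqForm_seq f j fun _ => 1

theorem seqForm_mem_mixedStrategies (f : ∀ j, X.Action j) : X.seqForm f ∈ X.mixedStrategies :=
  subset_convexHull ℝ _ ⟨f, rfl⟩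

theorem mixedStrategies_subset_conservativeVectors :
    X.mixedStrategies ⊆ X.conservativeVectors :=
  convexHull_min (Set.range_subset_iff.2 seqForm_mem_conservativeVectors)
    X.conservativeVectors.convex

theorem nonneg_of_mem_mixedStrategies {x : X.Seq → ℝ} (hx : x ∈ X.mixedStrategies) : 0 ≤ x :=
  convexHull_min (Set.range_subset_iff.2 seqForm_nonneg) (convex_Ici 0) hx

theorem apply_root_of_mem_mixedStrategies {x : X.Seq → ℝ} (hx : x ∈ X.mixedStrategies) :
    x X.root = 1 :=
  convexHull_min (Set.range_subset_iff.2 seqForm_root)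
    (convex_hyperplane (LinearMap.proj X.root).isLinear 1) hx

theorem isAntichain_mixedStrategies : IsAntichain (· ≤ ·) X.mixedStrategies := by
  intro x hx y hy hne hle
  refine hne (funext fun σ => ?_)
  induction σ using X.seq_induction with
  | root => rw [apply_root_of_mem_mixedStrategies hx, apply_root_of_mem_mixedStrategies hy]
  | seq j a ih =>
    rw [← mixedStrategies_subset_conservativeVectors hx,
      ← mixedStrategies_subset_conservativeVectors hy] at ih
    exact (Finset.sum_eq_sum_iff_of_le fun a _ => hle (X.seq j a)).1 ih a (Finset.mem_univ a)

/-! ### Nonnegative coefficients of a linear function on the pure strategies -/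

variable (X) in
/-- The vector whose entry at `ja` is the mass `u j` at `j`; it has no mass at the root. -/
noncomputable def incoming : (X.Dec → ℝ) →ₗ[ℝ] (X.Seq → ℝ) :=
  LinearMap.pi fun σ => σ.elim 0 fun s => LinearMap.proj s.1

variable (X) in
/-- The vector whose entry at `σ` is the total mass `u j` at the decision points `j ∈ C_σ`. -/
noncomputable def outgoing : (X.Dec → ℝ) →ₗ[ℝ] (X.Seq → ℝ) :=
  LinearMap.pi fun σ => ∑ j : {j : X.Dec // X.parent j = σ}, LinearMap.proj j.1

@[simp]
theorem incoming_root (u : X.Dec → ℝ) : X.incoming u X.root = 0 := rfl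

@[simp]
theorem incoming_seq (u : X.Dec → ℝ) (j : X.Dec) (a : X.Action j) :
    X.incoming u (X.seq j a) = u j := rfl

theorem outgoing_apply (u : X.Dec → ℝ) (σ : X.Seq) :
    X.outgoing u σ = ∑ j : {j : X.Dec // X.parent j = σ}, u j := by
  simp [outgoing]

theorem dotProduct_eq_root_add_sum (c x : X.Seq → ℝ) :
    c ⬝ᵥ x = c X.root * x X.root + ∑ j, ∑ a, c (X.seq j a) * x (X.seq j a) := by
  rw [dotProduct, Fintype.sum_option, Fintype.sum_sigma]

theorem incoming_dotProduct (u : X.Dec → ℝ) {x : X.Seq → ℝ} (hx : x ∈ X.conservativeVectors) :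
    X.incoming u ⬝ᵥ x = ∑ j, u j * x (X.parent j) := by
  simp only [dotProduct_eq_root_add_sum, incoming_root, incoming_seq, zero_mul, zero_add,
    ← Finset.mul_sum, mem_conservativeVectors.1 hx]

theorem outgoing_dotProduct (u : X.Dec → ℝ) (x : X.Seq → ℝ) :
    X.outgoing u ⬝ᵥ x = ∑ j, u j * x (X.parent j) := by
  simp only [dotProduct, outgoing_apply, Finset.sum_mul]
  rw [← Fintype.sum_sigma' fun σ (j : {j : X.Dec // X.parent j = σ}) => u j * x σ]
  refine Fintype.sum_equiv (Equiv.sigmaFiberEquiv X.parent) _ _ ?_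
  rintro ⟨_, j, rfl⟩
  rfl

/-- The least value that the linear function with coefficients `c` takes on the subtree below a
node, over all selections of actions there. -/
noncomputable def minValue (c : X.Seq → ℝ) : X.Node → ℝ
  | .obs σ => c σ + ∑ j : {j : X.Dec // X.parent j = σ}, minValue c (.dec j)
  | .dec j => ⨅ a, minValue c (.obs (X.seq j a))
termination_by s => wellFounded_depth_gt.wrap s
decreasing_by
  · exact depth_lt_depth_dec j.2
  · exact Nat.lt_succ_self _

theorem minValue_obs (c : X.Seq → ℝ) (σ : X.Seq) :
    minValue c (.obs σ) = c σ + X.outgoing (fun j => minValue c (.dec j)) σ := by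
  rw [minValue, outgoing_apply]

theorem minValue_dec (c : X.Seq → ℝ) (j : X.Dec) :
    minValue c (.dec j) = ⨅ a, minValue c (.obs (X.seq j a)) := by
  rw [minValue]

theorem minValue_dec_le (c : X.Seq → ℝ) (j : X.Dec) (a : X.Action j) :
    minValue c (.dec j) ≤ minValue c (.obs (X.seq j a)) := by
  rw [minValue_dec]
  exact ciInf_le (Set.finite_range _).bddBelow a

theorem exists_minValue_seq_eq (c : X.Seq → ℝ) (j : X.Dec) :
    ∃ a, minValue c (.obs (X.seq j a)) = minValue c (.dec j) := by
  rw [minValue_dec]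
  exact exists_eq_ciInf_of_finite

theorem sum_minValue_le {ι : Type*} (t : Finset ι) (c : ι → X.Seq → ℝ) (s : X.Node) :
    ∑ i ∈ t, minValue (c i) s ≤ minValue (∑ i ∈ t, c i) s := by
  induction s using X.node_induction_up with
  | obs σ ih =>
    simp only [minValue_obs, outgoing_apply, Finset.sum_add_distrib, Finset.sum_apply]
    rw [Finset.sum_comm]
    gcongr with j
    exact ih j j.2
  | dec j ih =>
    rw [minValue_dec (∑ i ∈ t, c i)]
    exact le_ciInf fun a => (Finset.sum_le_sum fun i _ => minValue_dec_le (c i) j a).trans (ih a)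

/-- The coefficients obtained from `c` by moving, at every decision point `j`, the mass
`minValue c (.dec j)` from each action at `j` up to `p_j`. This moves as much mass towards the root
as nonnegativity of the coefficients of the actions allows. -/
noncomputable def normalizedCoeff (c : X.Seq → ℝ) : X.Seq → ℝ :=
  c + X.outgoing (fun j => minValue c (.dec j)) - X.incoming (fun j => minValue c (.dec j))

theorem normalizedCoeff_root (c : X.Seq → ℝ) :
    normalizedCoeff c X.root = minValue c (.obs X.root) := by
  simp [normalizedCoeff, minValue_obs]

theorem normalizedCoeff_seq (c : X.Seq → ℝ) (j : X.Dec) (a : X.Action j) :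
    normalizedCoeff c (X.seq j a) = minValue c (.obs (X.seq j a)) - minValue c (.dec j) := by
  simp [normalizedCoeff, minValue_obs]

theorem normalizedCoeff_dotProduct (c : X.Seq → ℝ) {x : X.Seq → ℝ}
    (hx : x ∈ X.conservativeVectors) : normalizedCoeff c ⬝ᵥ x = c ⬝ᵥ x := by
  rw [normalizedCoeff, sub_dotProduct, add_dotProduct, incoming_dotProduct _ hx,
    outgoing_dotProduct, add_sub_cancel_right]

theorem exists_dotProduct_seqForm_eq_minValue (c : X.Seq → ℝ) :
    ∃ f, c ⬝ᵥ X.seqForm f = minValue c (.obs X.root) := by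
  choose f hf using exists_minValue_seq_eq c
  refine ⟨f, ?_⟩
  rw [← normalizedCoeff_dotProduct c (seqForm_mem_conservativeVectors f),
    dotProduct_eq_root_add_sum]
  simp only [sum_mul_seqForm_seq, normalizedCoeff_seq, hf, sub_self, zero_mul,
    Finset.sum_const_zero, add_zero, seqForm_root, mul_one, normalizedCoeff_root]

theorem normalizedCoeff_nonneg {c : X.Seq → ℝ} (hc : ∀ f, 0 ≤ c ⬝ᵥ X.seqForm f) :
    0 ≤ normalizedCoeff c := by
  rintro (_ | ⟨j, a⟩)
  · obtain ⟨f, hf⟩ := exists_dotProduct_seqForm_eq_minValue c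
    exact (hc f).trans_eq (hf.trans (normalizedCoeff_root c).symm)
  · exact (sub_nonneg.2 (minValue_dec_le c j a)).trans_eq (normalizedCoeff_seq c j a).symm

/-- The amount by which the least value of `∑ i ∈ t, c i` below a decision point exceeds the sum of
the least values of the summands. It is the mass that a normalization of the summands leaves further
away from the root than a normalization of the sum. -/
noncomputable def minValueExcess {ι : Type*} (t : Finset ι) (c : ι → X.Seq → ℝ) : X.Dec → ℝ :=
  (fun j => minValue (∑ i ∈ t, c i) (.dec j)) - ∑ i ∈ t, fun j => minValue (c i) (.dec j)

theorem minValueExcess_nonneg {ι : Type*} (t : Finset ι) (c : ι → X.Seq → ℝ) :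
    0 ≤ minValueExcess t c := fun j => by
  simpa [minValueExcess] using sum_minValue_le t c (.dec j)

theorem normalizedCoeff_sum_add_incoming {ι : Type*} (t : Finset ι) (c : ι → X.Seq → ℝ) :
    normalizedCoeff (∑ i ∈ t, c i) + X.incoming (minValueExcess t c) =
      ∑ i ∈ t, normalizedCoeff (c i) + X.outgoing (minValueExcess t c) := by
  simp only [minValueExcess, normalizedCoeff, map_sub, map_sum, Finset.sum_add_distrib,
    Finset.sum_sub_distrib]
  abel

end TreeFormDecisionProblem

namespace UTC

open TreeFormDecisionProblem

variable {X : TreeFormDecisionProblem.{u}} {Y : TreeFormDecisionProblem.{v}}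

/-! ### The play of a pure strategy -/

section Play

variable {π : PureStrategy X Y} {g : ∀ q, Y.Action q}

/-- The action that the deviator eventually plays at `j`, when arriving there with the mediator at
`τ`, together with the observation point of the mediator at which this happens. -/
noncomputable def finalMove (π : PureStrategy X Y) (g : ∀ q, Y.Action q) (j : X.Dec) (τ : Y.Seq) :
    X.Action j × Y.Seq :=
  match π j τ with
  | .inl a => (a, τ)
  | .inr q => finalMove π g j (Y.seq q (g q))
termination_by wellFounded_depth_gt.wrap (Node.obs τ)
decreasing_by exact depth_lt_depth_seq q.2 _

theorem finalMove_of_act {j : X.Dec} {τ : Y.Seq} {a : X.Action j} (h : π j τ = .inl a) :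
    finalMove π g j τ = (a, τ) := by
  rw [finalMove, h]

theorem finalMove_of_query {j : X.Dec} {τ : Y.Seq} {q : {q : Y.Dec // Y.parent q = τ}}
    (h : π j τ = .inr q) : finalMove π g j τ = finalMove π g j (Y.seq q (g q)) := by
  rw [finalMove, h]

/-- The observation point of the mediator when the deviator arrives at `σ`; meaningful only if the
deviator does arrive there. -/
noncomputable def mediatorState (π : PureStrategy X Y) (g : ∀ q, Y.Action q) : X.Seq → Y.Seq
  | none => none
  | some ⟨j, _⟩ => (finalMove π g j (mediatorState π g (X.parent j))).2
termination_by σ => (Node.obs σ).depth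
decreasing_by exact depth_lt_depth_seq rfl _

/-- The selection of actions that the deviator ends up playing in the real decision problem. -/
noncomputable def response (π : PureStrategy X Y) (g : ∀ q, Y.Action q) (j : X.Dec) : X.Action j :=
  (finalMove π g j (mediatorState π g (X.parent j))).1

theorem mediatorState_root : mediatorState π g X.root = Y.root := by
  rw [mediatorState]

theorem mediatorState_seq (j : X.Dec) (a : X.Action j) :
    mediatorState π g (X.seq j a) = (finalMove π g j (mediatorState π g (X.parent j))).2 := by
  rw [mediatorState]

/-- The nodes consistent with the play of `π` against `g`: the invariant from which the play is seen
to be deterministic. No node `(σ, q)` is ever reached. -/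
def OnPlay (π : PureStrategy X Y) (g : ∀ q, Y.Action q) : X.Node → Y.Node → Prop
  | .obs σ, .obs τ => X.Plays (response π g) σ ∧ mediatorState π g σ = τ ∧ Y.Plays g τ
  | .dec j, .obs τ => X.Plays (response π g) (X.parent j) ∧
      finalMove π g j τ = finalMove π g j (mediatorState π g (X.parent j)) ∧ Y.Plays g τ
  | .dec j, .dec q => X.Plays (response π g) (X.parent j) ∧
      finalMove π g j (Y.seq q (g q)) = finalMove π g j (mediatorState π g (X.parent j)) ∧
      Y.Plays g (Y.parent q)
  | .obs _, .dec _ => False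

theorem Reaches.onPlay {s : X.Node} {t : Y.Node} (h : Reaches π (Y.seqForm g) s t) :
    OnPlay π g s t := by
  induction h with
  | root => exact ⟨.root, mediatorState_root, .root⟩
  | observe j τ _ ih => exact ⟨ih.1, by rw [ih.2.1], ih.2.2⟩
  | act j τ a _ ha ih =>
    obtain ⟨hplays, hmove, hτ⟩ := ih
    rw [finalMove_of_act ha] at hmove
    refine ⟨plays_seq.2 ⟨?_, hplays⟩, ?_, hτ⟩
    · rw [response, ← hmove]
    · rw [mediatorState_seq, ← hmove]
  | query j τ q _ hq ih =>
    obtain ⟨hplays, hmove, hτ⟩ := ih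
    exact ⟨hplays, by rw [← finalMove_of_query hq, hmove], by rwa [q.2]⟩
  | reply j q b _ hb ih =>
    obtain ⟨hplays, hmove, -⟩ := ih
    rw [seqForm_eq_one_iff] at hb
    obtain ⟨rfl, -⟩ := plays_seq.1 hb
    exact ⟨hplays, hmove, hb⟩

theorem Reaches.finalMove {j : X.Dec} {τ : Y.Seq}
    (h : Reaches π (Y.seqForm g) (.dec j) (.obs τ)) :
    Reaches π (Y.seqForm g) (.obs (X.seq j (finalMove π g j τ).1))
      (.obs (finalMove π g j τ).2) := by
  induction τ using finalMove.induct π g j with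
  | case1 τ a hact =>
    rw [finalMove_of_act hact]
    exact .act j τ a h hact
  | case2 τ q hquery ih =>
    rw [finalMove_of_query hquery]
    refine ih (.reply (Y := Y) j q.1 (g q.1) (.query j τ q h hquery) ?_)
    exact seqForm_eq_one_iff.2 (.step q.1 (by rw [q.2]; exact h.onPlay.2.2))

theorem reaches_mediatorState {σ : X.Seq} (h : X.Plays (response π g) σ) :
    Reaches π (Y.seqForm g) (.obs σ) (.obs (mediatorState π g σ)) := by
  induction h with
  | root => rw [mediatorState_root]; exact .root
  | step j _ ih =>
    rw [mediatorState_seq]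
    exact (Reaches.observe j _ ih).finalMove

theorem reaches_seqForm_iff {σ : X.Seq} {τ : Y.Seq} :
    Reaches π (Y.seqForm g) (.obs σ) (.obs τ) ↔
      X.Plays (response π g) σ ∧ mediatorState π g σ = τ :=
  ⟨fun h => ⟨h.onPlay.1, h.onPlay.2.1⟩, fun ⟨h, hτ⟩ => hτ ▸ reaches_mediatorState h⟩

theorem playsTo_seqForm_iff {σ : X.Seq} :
    PlaysTo π (Y.seqForm g) σ ↔ X.Plays (response π g) σ := by
  simp [PlaysTo, reaches_seqForm_iff]

/-- The node can be reached under some replies of the mediator: for the constant vector `1` every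
action is a possible reply. -/
abbrev Reachable (π : PureStrategy X Y) : X.Node → Y.Node → Prop := Reaches π 1

theorem Reaches.reachable {y : Y.Seq → ℝ} {s : X.Node} {t : Y.Node} (h : Reaches π y s t) :
    Reachable π s t := by
  induction h with
  | root => exact .root
  | observe j τ _ ih => exact .observe j τ ih
  | act j τ a _ ha ih => exact .act j τ a ih ha
  | query j τ q _ hq ih => exact .query j τ q ih hq
  | reply j q b _ _ ih => exact .reply j q b ih rfl

/-- The last observation point on the path to a node of the tree. -/
def lastSeq : Y.Node → Y.Seq
  | .obs τ => τ
  | .dec q => Y.parent q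

theorem Reachable.reaches_seqForm {s : X.Node} {t : Y.Node} (h : Reachable π s t)
    (ht : Y.Plays g (lastSeq t)) : Reaches π (Y.seqForm g) s t := by
  induction h with
  | root => exact .root
  | observe j τ _ ih => exact .observe j τ (ih ht)
  | act j τ a _ ha ih => exact .act j τ a (ih ht) ha
  | query j τ q _ hq ih => exact .query j τ q (ih (q.2 ▸ ht)) hq
  | reply j q b _ _ ih =>
    exact .reply j q b (ih (plays_seq.1 ht).2) (seqForm_eq_one_iff.2 ht)

theorem reachable_and_plays_iff {σ : X.Seq} {τ : Y.Seq} :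
    Reachable π (.obs σ) (.obs τ) ∧ Y.Plays g τ ↔
      X.Plays (response π g) σ ∧ mediatorState π g σ = τ := by
  rw [← reaches_seqForm_iff]
  exact ⟨fun h => h.1.reaches_seqForm h.2, fun h => ⟨h.reachable, h.onPlay.2.2⟩⟩

open Classical in
theorem sum_reachable_seqForm (π : PureStrategy X Y) (g : ∀ q, Y.Action q) (σ : X.Seq) :
    ∑ τ with Reachable π (.obs σ) (.obs τ), Y.seqForm g τ = X.seqForm (response π g) σ := by
  simp only [Finset.sum_filter, seqForm, ← ite_and, reachable_and_plays_iff]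
  simp [ite_and]

end Play

/-! ### Induced functions are linear maps into `co 𝒳` -/

open Classical in
/-- The probability that `(s, t)` is reached under some replies of the mediator. -/
noncomputable def reachProb (w : stdSimplex ℝ (PureStrategy X Y)) (s : X.Node) (t : Y.Node) : ℝ :=
  ∑ π with Reachable π s t, w π

theorem inducedMap_seqForm (w : stdSimplex ℝ (PureStrategy X Y)) (g : ∀ q, Y.Action q) :
    inducedMap w ⟨Y.seqForm g, g, rfl⟩ = ∑ π, w π • X.seqForm (response π g) := by
  ext σ
  simp only [inducedMap, Finset.sum_apply, Pi.smul_apply, smul_eq_mul]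
  refine Finset.sum_congr rfl fun π _ => ?_
  by_cases h : X.Plays (response π g) σ
  · rw [if_pos (playsTo_seqForm_iff.2 h), seqForm_eq_one_iff.2 h, mul_one]
    rfl
  · rw [if_neg (mt playsTo_seqForm_iff.1 h), seqForm, if_neg h, mul_zero]

theorem inducedMap_mem_mixedStrategies (w : stdSimplex ℝ (PureStrategy X Y))
    (y : Y.pureStrategies) : inducedMap w y ∈ X.mixedStrategies := by
  obtain ⟨_, g, rfl⟩ := y
  rw [inducedMap_seqForm]
  exact (convex_convexHull ℝ _).sum_mem (fun π _ => stdSimplex.zero_le w π)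
    (stdSimplex.sum_eq_one w) fun π _ => seqForm_mem_mixedStrategies _

/-- The matrix of reaching probabilities of the pairs of observation points. -/
noncomputable def reachMatrix (w : stdSimplex ℝ (PureStrategy X Y)) : Matrix X.Seq Y.Seq ℝ :=
  Matrix.of fun σ τ => reachProb w (.obs σ) (.obs τ)

theorem inducedMap_eq_mulVec (w : stdSimplex ℝ (PureStrategy X Y)) (y : Y.pureStrategies) :
    inducedMap w y = reachMatrix w *ᵥ y := by
  classical
  obtain ⟨_, g, rfl⟩ := y
  ext σ
  simp only [inducedMap_seqForm, Finset.sum_apply, Pi.smul_apply, smul_eq_mul, Matrix.mulVec,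
    dotProduct, reachMatrix, Matrix.of_apply, reachProb, ← sum_reachable_seqForm, Finset.sum_filter,
    Finset.sum_mul, Finset.mul_sum]
  rw [Finset.sum_comm]
  simp only [mul_ite, ite_mul, mul_zero, zero_mul]

theorem inducedMap_mem_linearMaps (w : stdSimplex ℝ (PureStrategy X Y)) :
    inducedMap w ∈ linearMaps Y X :=
  ⟨inducedMap_mem_mixedStrategies w, (reachMatrix w).mulVecLin, inducedMap_eq_mulVec w⟩

/-! ### Behavioral strategies -/

instance nonemptyChoice (j : X.Dec) (τ : Y.Seq) : Nonempty (Choice X Y j τ) :=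
  ⟨.inl (Classical.arbitrary _)⟩

variable (X Y) in
/-- A behavioral strategy of the deviator: a probability distribution on the choices at each
decision point. -/
abbrev BehavioralStrategy : Type (max u v) :=
  ∀ (j : X.Dec) (τ : Y.Seq), stdSimplex ℝ (Choice X Y j τ)

/-- The mixed strategy that makes the choices of a behavioral strategy independently. -/
noncomputable def BehavioralStrategy.toMixed (β : BehavioralStrategy X Y) :
    stdSimplex ℝ (PureStrategy X Y) where
  val π := ∏ p : (_ : X.Dec) × Y.Seq, β p.1 p.2 (π p.1 p.2)
  property := by
    classical
    refine ⟨fun π => Finset.prod_nonneg fun p _ => stdSimplex.zero_le _ _, ?_⟩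
    rw [← (Equiv.piCurry fun j τ => Choice X Y j τ).sum_comp]
    exact (Fintype.prod_sum fun (p : (_ : X.Dec) × Y.Seq) c => β p.1 p.2 c).symm.trans
      (Finset.prod_eq_one fun p _ => stdSimplex.sum_eq_one _)

theorem Reaches.congr {π π' : PureStrategy X Y} {y : Y.Seq → ℝ} {s : X.Node} {t : Y.Node}
    (h : Reaches π y s t)
    (hπ : ∀ i ρ, (Node.dec i).depth + (Node.obs ρ).depth < s.depth + t.depth → π i ρ = π' i ρ) :
    Reaches π' y s t := by
  induction h with
  | root => exact .root
  | observe j τ _ ih =>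
    have hlt := depth_lt_depth_dec (rfl : X.parent j = _)
    exact .observe j τ (ih fun i ρ h => hπ i ρ (h.trans (by gcongr)))
  | act j τ a _ ha ih =>
    have hlt := (depth_seq j a).ge
    exact .act j τ a (ih fun i ρ h => hπ i ρ (by lia)) ((hπ j τ (by lia)).symm.trans ha)
  | query j τ q _ hq ih =>
    have hlt := depth_lt_depth_dec q.2
    exact .query j τ q (ih fun i ρ h => hπ i ρ (by lia)) ((hπ j τ (by lia)).symm.trans hq)
  | reply j q b _ hb ih =>
    have hlt := (depth_seq q b).ge
    exact .reply j q b (ih fun i ρ h => hπ i ρ (by lia)) hb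

open Classical in
/-- No path visits a node twice, so the choice at `(j, τ)` is independent of whether `(j, τ)` is
reached. -/
theorem sum_toMixed_choice (β : BehavioralStrategy X Y) (j : X.Dec) (τ : Y.Seq)
    (c : Choice X Y j τ) :
    ∑ π with Reachable π (.dec j) (.obs τ) ∧ π j τ = c, β.toMixed π =
      β j τ c * reachProb β.toMixed (.dec j) (.obs τ) := by
  let curry := Equiv.piCurry fun (j : X.Dec) (τ : Y.Seq) => Choice X Y j τ
  let E : (∀ p : (_ : X.Dec) × Y.Seq, Choice X Y p.1 p.2) → Prop :=
    fun p => Reachable (curry p) (.dec j) (.obs τ)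
  have reachable_of_agree {p p'} (h : ∀ k ∈ ({⟨j, τ⟩} : Set _)ᶜ, p k = p' k) (hp : E p) : E p' :=
    Reaches.congr hp fun i ρ hlt => h ⟨i, ρ⟩ fun heq => by
      cases heq
      exact lt_irrefl _ hlt
  have hE : DependsOn E {⟨j, τ⟩}ᶜ := fun p p' h => propext
    ⟨reachable_of_agree h, reachable_of_agree fun k hk => (h k hk).symm⟩
  have key := sum_prod_filter_apply_eq (fun p : (_ : X.Dec) × Y.Seq => ⇑(β p.1 p.2))
    (stdSimplex.sum_eq_one _) hE c
  simp only [reachProb, Finset.sum_filter] at key ⊢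
  rwa [← curry.sum_comp, ← curry.sum_comp fun π => ite _ _ _]

section ReachProb

variable {π : PureStrategy X Y} {y : Y.Seq → ℝ} {j : X.Dec} {τ : Y.Seq}

theorem reaches_root_iff : Reaches π y (.obs X.root) (.obs τ) ↔ τ = Y.root := by
  constructor
  · intro h
    cases h
    rfl
  · rintro rfl
    exact .root

theorem reaches_seq_iff {a : X.Action j} :
    Reaches π y (.obs (X.seq j a)) (.obs τ) ↔
      Reaches π y (.dec j) (.obs τ) ∧ π j τ = .inl a := by
  refine ⟨fun h => ?_, fun h => .act j τ a h.1 h.2⟩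
  cases h with
  | act _ _ _ h ha => exact ⟨h, ha⟩

theorem reaches_dec_dec_iff {q : Y.Dec} :
    Reaches π y (.dec j) (.dec q) ↔
      Reaches π y (.dec j) (.obs (Y.parent q)) ∧ π j (Y.parent q) = .inr ⟨q, rfl⟩ := by
  refine ⟨fun h => ?_, fun h => .query j _ ⟨q, rfl⟩ h.1 h.2⟩
  cases h with
  | query _ _ q' h hq =>
    obtain ⟨q, rfl⟩ := q'
    exact ⟨h, hq⟩

theorem Reaches.of_dec_root (h : Reaches π y (.dec j) (.obs Y.root)) :
    Reaches π y (.obs (X.parent j)) (.obs Y.root) := by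
  cases h with
  | observe _ _ h => exact h

theorem Reaches.of_dec_seq {q : Y.Dec} {b : Y.Action q}
    (h : Reaches π y (.dec j) (.obs (Y.seq q b))) :
    Reaches π y (.obs (X.parent j)) (.obs (Y.seq q b)) ∨ Reaches π y (.dec j) (.dec q) := by
  cases h with
  | observe _ _ h => exact .inl h
  | reply _ _ _ h _ => exact .inr h

theorem reachProb_root_root (w : stdSimplex ℝ (PureStrategy X Y)) :
    reachProb w (.obs X.root) (.obs Y.root) = 1 := by
  simp [reachProb, reaches_root_iff]

theorem reachProb_root_seq (w : stdSimplex ℝ (PureStrategy X Y)) (q : Y.Dec) (b : Y.Action q) :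
    reachProb w (.obs X.root) (.obs (Y.seq q b)) = 0 := by
  simp [reachProb, reaches_root_iff]

theorem reachProb_seq (β : BehavioralStrategy X Y) (j : X.Dec) (a : X.Action j) (τ : Y.Seq) :
    reachProb β.toMixed (.obs (X.seq j a)) (.obs τ) =
      β j τ (.inl a) * reachProb β.toMixed (.dec j) (.obs τ) := by
  classical
  rw [← sum_toMixed_choice, reachProb]
  exact Finset.sum_congr (Finset.filter_congr fun π _ => reaches_seq_iff) fun _ _ => rfl

theorem reachProb_dec_dec (β : BehavioralStrategy X Y) (j : X.Dec) (q : Y.Dec) :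
    reachProb β.toMixed (.dec j) (.dec q) =
      β j (Y.parent q) (.inr ⟨q, rfl⟩) * reachProb β.toMixed (.dec j) (.obs (Y.parent q)) := by
  classical
  rw [← sum_toMixed_choice, reachProb]
  exact Finset.sum_congr (Finset.filter_congr fun π _ => reaches_dec_dec_iff) fun _ _ => rfl

theorem reachProb_dec_root_le (w : stdSimplex ℝ (PureStrategy X Y)) (j : X.Dec) :
    reachProb w (.dec j) (.obs Y.root) ≤ reachProb w (.obs (X.parent j)) (.obs Y.root) := by
  classical
  exact Finset.sum_le_sum_of_subset_of_nonneg
    (Finset.monotone_filter_right _ fun π _ => Reaches.of_dec_root)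
    fun π _ _ => stdSimplex.zero_le w π

theorem reachProb_dec_seq_le (w : stdSimplex ℝ (PureStrategy X Y)) (j : X.Dec) (q : Y.Dec)
    (b : Y.Action q) :
    reachProb w (.dec j) (.obs (Y.seq q b)) ≤
      reachProb w (.obs (X.parent j)) (.obs (Y.seq q b)) + reachProb w (.dec j) (.dec q) := by
  classical
  rw [reachProb, reachProb, reachProb, ← Finset.sum_union_inter, ← Finset.filter_or]
  refine (Finset.sum_le_sum_of_subset_of_nonneg
    (Finset.monotone_filter_right _ fun π _ => Reaches.of_dec_seq)
    fun π _ _ => stdSimplex.zero_le w π).trans (le_add_of_nonneg_right ?_)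
  exact Finset.sum_nonneg fun π _ => stdSimplex.zero_le w π

end ReachProb

/-! ### Flows -/

/-- The flow that enters `(j, τ)`: from `(p_j, τ)` and, if `τ = qb`, from `(j, q)`. -/
noncomputable def inflow (A : X.Seq → Y.Seq → ℝ) (z : X.Dec → Y.Dec → ℝ) (j : X.Dec) (τ : Y.Seq) :
    ℝ :=
  A (X.parent j) τ + Y.incoming (z j) τ

/-- The flow that leaves `(j, τ)` along each of the choices available there. -/
def outflow (A : X.Seq → Y.Seq → ℝ) (z : X.Dec → Y.Dec → ℝ) (j : X.Dec) (τ : Y.Seq) :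
    Choice X Y j τ → ℝ :=
  Sum.elim (fun a => A (X.seq j a) τ) (fun q => z j q)

theorem reachProb_dec_le_inflow {β : BehavioralStrategy X Y} {A : X.Seq → Y.Seq → ℝ}
    {z : X.Dec → Y.Dec → ℝ}
    (hβ : ∀ j τ c, β j τ c * inflow A z j τ = outflow A z j τ c) {j : X.Dec}
    (hj : ∀ τ, reachProb β.toMixed (.obs (X.parent j)) (.obs τ) ≤ A (X.parent j) τ) (τ : Y.Seq) :
    reachProb β.toMixed (.dec j) (.obs τ) ≤ inflow A z j τ := by
  induction τ using Y.seq_induction with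
  | root => simpa [inflow] using (reachProb_dec_root_le _ _).trans (hj _)
  | seq q b ih =>
    have hq : reachProb β.toMixed (.dec j) (.dec q) ≤ z j q := by
      rw [reachProb_dec_dec]
      exact (mul_le_mul_of_nonneg_left ih (stdSimplex.zero_le _ _)).trans_eq (hβ _ _ _)
    exact (reachProb_dec_seq_le _ _ _ _).trans (add_le_add (hj _) hq)

/-- A unit flow on the decision problem of the deviator: `A σ τ` flows through `(σ, τ)` and `z j q`
flows through `(j, q)`. All of the flow through an observation point continues to each of its
successors. At the nodes `(∅, τ)` with `τ ≠ ∅`, which are never reached, `A` is only required to be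
nonnegative: a flow serves as an upper bound on the probabilities of reaching the nodes. -/
structure IsFlow (A : X.Seq → Y.Seq → ℝ) (z : X.Dec → Y.Dec → ℝ) : Prop where
  nonneg : 0 ≤ A
  query_nonneg : 0 ≤ z
  root : A X.root Y.root = 1
  conserve : ∀ j τ, inflow A z j τ = ∑ c, outflow A z j τ c

namespace IsFlow

variable {A : X.Seq → Y.Seq → ℝ} {z : X.Dec → Y.Dec → ℝ}

theorem outflow_nonneg (h : IsFlow A z) (j : X.Dec) (τ : Y.Seq) : 0 ≤ outflow A z j τ := by
  rintro (a | q)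
  · exact h.nonneg _ _
  · exact h.query_nonneg _ _

theorem exists_behavioralStrategy (h : IsFlow A z) :
    ∃ β : BehavioralStrategy X Y, ∀ j τ c, β j τ c * inflow A z j τ = outflow A z j τ c := by
  choose β hβ using fun j τ => exists_stdSimplex_mul_sum_eq (h.outflow_nonneg j τ)
  exact ⟨β, fun j τ c => by rw [h.conserve, hβ]⟩

theorem reachProb_le (h : IsFlow A z) {β : BehavioralStrategy X Y}
    (hβ : ∀ j τ c, β j τ c * inflow A z j τ = outflow A z j τ c) (σ : X.Seq) (τ : Y.Seq) :
    reachProb β.toMixed (.obs σ) (.obs τ) ≤ A σ τ := by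
  induction σ using X.seq_induction generalizing τ with
  | root =>
    rcases τ with _ | ⟨q, b⟩
    · rw [reachProb_root_root, h.root]
    · rw [reachProb_root_seq]
      exact h.nonneg _ _
  | seq j a ih =>
    rw [reachProb_seq]
    have hj := reachProb_dec_le_inflow hβ ih τ
    exact (mul_le_mul_of_nonneg_left hj (stdSimplex.zero_le _ _)).trans_eq (hβ _ _ _)

theorem exists_reachMatrix_le (h : IsFlow A z) :
    ∃ w : stdSimplex ℝ (PureStrategy X Y), ∀ σ τ, reachMatrix w σ τ ≤ A σ τ := by
  obtain ⟨β, hβ⟩ := h.exists_behavioralStrategy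
  exact ⟨β.toMixed, h.reachProb_le hβ⟩

end IsFlow

/-! ### Linear maps into `co 𝒳` are induced -/

theorem exists_conservative_coeff {φ : Y.pureStrategies → X.Seq → ℝ} (hφ : φ ∈ linearMaps Y X) :
    ∃ c : X.Seq → Y.Seq → ℝ, (∀ j, ∑ a, c (X.seq j a) = c (X.parent j)) ∧
      ∀ y : Y.pureStrategies, ∀ σ, c σ ⬝ᵥ y = φ y σ := by
  classical
  obtain ⟨hmem, L, hL⟩ := hφ
  obtain ⟨L', hL', hU⟩ := exists_linearMap_eqOn_forall_mem L (S := Y.pureStrategies)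
    (U := X.conservativeVectors) fun y hy =>
      hL ⟨y, hy⟩ ▸ mixedStrategies_subset_conservativeVectors (hmem ⟨y, hy⟩)
  refine ⟨L'.toMatrix', fun j => ?_, fun y σ => ?_⟩
  · ext τ
    rw [Finset.sum_apply]
    exact hU (Pi.single τ 1) j
  · rw [hL, ← hL' y.2]
    exact congr_fun (L'.toMatrix'_mulVec y) σ

theorem isFlow_normalizedCoeff {c : X.Seq → Y.Seq → ℝ}
    (hc : ∀ j, ∑ a, c (X.seq j a) = c (X.parent j)) (hnonneg : ∀ σ g, 0 ≤ c σ ⬝ᵥ Y.seqForm g)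
    (hroot : ∀ g, c X.root ⬝ᵥ Y.seqForm g = 1) :
    IsFlow (fun σ => normalizedCoeff (c σ))
      (fun j => minValueExcess Finset.univ fun a => c (X.seq j a)) where
  nonneg σ := normalizedCoeff_nonneg (hnonneg σ)
  query_nonneg j := minValueExcess_nonneg _ _
  root := by
    obtain ⟨g, hg⟩ := exists_dotProduct_seqForm_eq_minValue (c X.root)
    rw [normalizedCoeff_root, ← hg, hroot]
  conserve j τ := by
    have hmass := congr_fun (normalizedCoeff_sum_add_incoming Finset.univ fun a => c (X.seq j a)) τ
    rw [hc] at hmass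
    simpa [inflow, outflow, outgoing_apply] using hmass

theorem exists_inducedMap_eq {φ : Y.pureStrategies → X.Seq → ℝ} (hφ : φ ∈ linearMaps Y X) :
    ∃ w : stdSimplex ℝ (PureStrategy X Y), inducedMap w = φ := by
  obtain ⟨c, hc, hcφ⟩ := exists_conservative_coeff hφ
  have hflow := isFlow_normalizedCoeff hc
    (fun σ g =>
      (nonneg_of_mem_mixedStrategies (hφ.1 ⟨_, g, rfl⟩) σ).trans_eq (hcφ ⟨_, g, rfl⟩ σ).symm)
    (fun g => (hcφ ⟨_, g, rfl⟩ X.root).trans (apply_root_of_mem_mixedStrategies (hφ.1 _)))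
  obtain ⟨w, hw⟩ := hflow.exists_reachMatrix_le
  refine ⟨w, funext fun y => isAntichain_mixedStrategies.eq (inducedMap_mem_mixedStrategies w y)
    (hφ.1 y) fun σ => ?_⟩
  obtain ⟨_, g, rfl⟩ := y
  calc inducedMap w ⟨Y.seqForm g, g, rfl⟩ σ
      = reachMatrix w σ ⬝ᵥ Y.seqForm g := by rw [inducedMap_eq_mulVec]; rfl
    _ ≤ normalizedCoeff (c σ) ⬝ᵥ Y.seqForm g :=
      dotProduct_le_dotProduct_of_nonneg_right (hw σ) (seqForm_nonneg g)
    _ = c σ ⬝ᵥ Y.seqForm g := normalizedCoeff_dotProduct _ (seqForm_mem_conservativeVectors g)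
    _ = φ ⟨Y.seqForm g, g, rfl⟩ σ := hcφ ⟨_, g, rfl⟩ σ

end UTC

theorem mainTheorem4 (X : TreeFormDecisionProblem.{u}) (Y : TreeFormDecisionProblem.{v}) :
    TreeFormDecisionProblem.linearMaps Y X =
      Set.range (UTC.inducedMap : stdSimplex ℝ (UTC.PureStrategy X Y) →
        Y.pureStrategies → X.Seq → ℝ) := by
  ext φ
  refine ⟨UTC.exists_inducedMap_eq, ?_⟩
  rintro ⟨w, rfl⟩
  exact UTC.inducedMap_mem_linearMaps w
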